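/- Let $K$ be a field of characteristic zero. For $g\ge 1$ let $F_g$ be the free Lie algebra over $K$ on $g$ generators. For a Lie algebra $L$ write $L^1=L$ and $L^{k+1}=[L,L^k]$. Put $F_{g,c}=F_g/F_g^{c+1}$ and let $$M_{g,c}=F_{g,c}/[F_{g,c}^2,F_{g,c}^2]$$ be the free metabelian $c$-step nilpotent Lie algebra on $g$ generators. For a finite-dimensional Lie algebra $\mathfrak g$ over $K$, let $$\chi(\mathfrak g)=\inf\{\dim\mathfrak g(\ell)\mid \ell\in\mathfrak g^*\},\qquad \mathfrak g(\ell)=\{y\in\mathfrak g\mid \ell([x,y])=0\ \ \forall x\in\mathfrak g\},$$ be the index of $\mathfrak g$, and let $\alpha(\mathfrak g)$ be the maximal dimension of an abelian subalgebra of $\mathfrak g$. Let $g\ge 3$ and $c\ge 3$. Then $\mathfrak g=M_{g,c}$ is finite-dimensional and $$\chi(\mathfrak g)=\dim\mathfrak g-2g=2\alpha(\mathfrak g)-\dim\mathfrak g .$$ In particular $\alpha(\mathfrak g)=\dim\mathfrak g-g$. -/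

import Mathlib

namespace LieIndex

section Invariants

variable (K : Type*) [Field K] {L : Type*} [LieRing L] [LieAlgebra K L]

/-- The radical `L(ℓ) = {y ∈ L | ℓ([x, y]) = 0 for all x ∈ L}` of the skew-symmetric bilinear form
`B_ℓ(x, y) = ℓ([x, y])` attached to a linear form `ℓ` on `L`. It is a Lie subalgebra. -/
def radical (l : Module.Dual K L) : LieSubalgebra K L where
  carrier := {y | ∀ x : L, l ⁅x, y⁆ = 0}
  zero_mem' := fun x => by simp
  add_mem' := fun {a b} ha hb x => by
    rw [lie_add, map_add, ha x, hb x, add_zero]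
  smul_mem' := fun t a ha x => by
    rw [lie_smul, map_smul, ha x, smul_zero]
  lie_mem' := fun {a b} ha hb x => by
    rw [leibniz_lie, map_add, hb, ← lie_skew, map_neg, ha, neg_zero, add_zero]

variable (L)

/-- The index `χ(L) = inf {dim L(ℓ) | ℓ ∈ L*}` of a finite-dimensional Lie algebra `L`. -/
noncomputable def index : ℕ :=
  ⨅ l : Module.Dual K L, Module.finrank K (radical K l)

/-- The maximal dimension `α(L)` of an abelian subalgebra of a finite-dimensional Lie algebra
`L`. -/
noncomputable def alpha : ℕ :=
  sSup {d : ℕ | ∃ H : LieSubalgebra K L, IsLieAbelian H ∧ Module.finrank K H = d}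

end Invariants

section FreeMetabelian

/-- The term `L^k` (for `k ≥ 1`) of the lower central series numbered so that `L^1 = L` and
`L^(k+1) = [L, L^k]`; Mathlib numbers the same series from `0`. -/
abbrev lcsTerm (K : Type*) [Field K] (L : Type*) [LieRing L] [LieAlgebra K L] (k : ℕ) :
    LieIdeal K L :=
  LieModule.lowerCentralSeries K L L (k - 1)

/-- The free `c`-step nilpotent Lie algebra `F_{g,c} = F_g / F_g^(c+1)` on `g` generators. -/
abbrev FreeNilpotent (K : Type*) [Field K] (g c : ℕ) : Type _ :=
  FreeLieAlgebra K (Fin g) ⧸ lcsTerm K (FreeLieAlgebra K (Fin g)) (c + 1)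

/-- The free metabelian `c`-step nilpotent Lie algebra
`M_{g,c} = F_{g,c} / [F_{g,c}^2, F_{g,c}^2]` on `g` generators. -/
abbrev FreeMetabelian (K : Type*) [Field K] (g c : ℕ) : Type _ :=
  FreeNilpotent K g c ⧸
    (⁅lcsTerm K (FreeNilpotent K g c) 2, lcsTerm K (FreeNilpotent K g c) 2⁆ :
      LieIdeal K (FreeNilpotent K g c))

end FreeMetabelian

end LieIndex

/-! The derived ideal is abelian of codimension at most `g`, hence isotropic for every form `ℓ([x,
y])`. An isotropic subspace `H` satisfies `2 dim H ≤ dim L + dim L(ℓ)` (`two_mul_finrank_le`), so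
the index is at least `dim L - 2g`. Conversely, a single `ℓ` with `dim L(ℓ) ≤ dim L - 2g` makes this
bound sharp, and the same inequality for that `ℓ` caps every abelian subalgebra at `dim L - g`
(`index_and_alpha_eq`). Such an `ℓ` is pulled back from a small 3-step metabelian algebra,
`ShiftAlgebra`, where the top coordinate pairs the generators `x i` dually with the commutators `[x
j, x (σ j)]`. -/

namespace LieIndex

/-! ### Generation, nilpotency, and isotropic subspaces -/

section General

variable {K : Type*} [Field K] {L L' : Type*} [LieRing L] [LieAlgebra K L]
  [LieRing L'] [LieAlgebra K L']

/-- A homomorphism of Lie algebras that kills an ideal descends to the quotient. -/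
def quotientLift (I : LieIdeal K L) (f : L →ₗ⁅K⁆ L') (h : ∀ x ∈ I, f x = 0) :
    (L ⧸ I) →ₗ⁅K⁆ L' :=
  { I.toSubmodule.liftQ (f : L →ₗ[K] L') (fun x hx => h x hx) with
    map_lie' := by
      intro a b
      induction a using Submodule.Quotient.induction_on with | _ a => ?_
      induction b using Submodule.Quotient.induction_on with | _ b => ?_
      exact f.map_lie a b }

/-- The projection onto a quotient by an ideal, as a homomorphism of Lie algebras. -/
def quotientMk (I : LieIdeal K L) : L →ₗ⁅K⁆ (L ⧸ I) :=
  { (LieSubmodule.Quotient.mk' I : L →ₗ[K] L ⧸ I) with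
    map_lie' := fun {x y} => LieSubmodule.Quotient.mk_bracket I x y }

theorem quotientMk_surjective (I : LieIdeal K L) : Function.Surjective (quotientMk I) :=
  LieSubmodule.Quotient.surjective_mk' I

theorem quotientMk_eq_zero {I : LieIdeal K L} {x : L} : quotientMk I x = 0 ↔ x ∈ I :=
  LieSubmodule.Quotient.mk_eq_zero I

theorem map_mem_lowerCentralSeries (f : L →ₗ⁅K⁆ L') (k : ℕ) {x : L}
    (hx : x ∈ LieModule.lowerCentralSeries K L L k) :
    f x ∈ LieModule.lowerCentralSeries K L' L' k :=
  LieIdeal.map_lowerCentralSeries_le k (LieIdeal.mem_map hx)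

theorem lowerCentralSeries_eq_bot_of_surjective {f : L →ₗ⁅K⁆ L'} (hf : Function.Surjective f)
    {k : ℕ} (h : ∀ x ∈ LieModule.lowerCentralSeries K L L k, f x = 0) :
    LieModule.lowerCentralSeries K L' L' k = ⊥ := by
  rw [← LieIdeal.lowerCentralSeries_map_eq k hf, LieIdeal.map_eq_bot_iff]
  exact fun x hx => h x hx

/-- A subspace that contains Lie algebra generators and is stable under bracketing with them from
the left is everything. -/
theorem submodule_eq_top_of_lie_mem {ι : Type*} {x : ι → L}
    (hx : LieSubalgebra.lieSpan K L (Set.range x) = ⊤) (W : Submodule K L)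
    (hW : ∀ i, x i ∈ W) (hlie : ∀ i, ∀ w ∈ W, ⁅x i, w⁆ ∈ W) : W = ⊤ := by
  -- The elements whose bracket preserves `W` form a Lie subalgebra.
  have key : ∀ u : L, ∀ w ∈ W, ⁅u, w⁆ ∈ W := by
    intro u
    have hu : u ∈ LieSubalgebra.lieSpan K L (Set.range x) := by rw [hx]; trivial
    induction hu using LieSubalgebra.lieSpan_induction with
    | mem y hy => obtain ⟨i, rfl⟩ := hy; exact hlie i
    | zero => intro w _; rw [zero_lie]; exact W.zero_mem
    | add a b _ _ ha hb => intro w hw; rw [add_lie]; exact W.add_mem (ha w hw) (hb w hw)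
    | smul t a _ ha => intro w hw; rw [smul_lie]; exact W.smul_mem t (ha w hw)
    | lie a b _ _ ha hb =>
      intro w hw
      rw [lie_lie]
      exact W.sub_mem (ha _ (hb w hw)) (hb _ (ha w hw))
  let S : LieSubalgebra K L := { W with lie_mem' := fun {a b} _ hb => key a b hb }
  have hS : LieSubalgebra.lieSpan K L (Set.range x) ≤ S := by
    rw [LieSubalgebra.lieSpan_le]
    rintro _ ⟨i, rfl⟩
    exact hW i
  rw [hx] at hS
  exact eq_top_iff.2 fun u _ => hS (LieSubalgebra.mem_top u)

/-- The span of the left-normed words of length `n + 1` in the elements `x i`. -/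
def wordSpan (K : Type*) [Field K] {L : Type*} [LieRing L] [LieAlgebra K L] {ι : Type*}
    (x : ι → L) : ℕ → Submodule K L
  | 0 => Submodule.span K (Set.range x)
  | n + 1 => ⨆ i, (wordSpan K x n).map (LieAlgebra.ad K L (x i) : L →ₗ[K] L)

theorem finite_wordSpan {ι : Type*} [Finite ι] (x : ι → L) (n : ℕ) :
    Module.Finite K (wordSpan K x n) := by
  induction n with
  | zero => exact Module.Finite.span_of_finite K (Set.finite_range x)
  | succ n ih => rw [wordSpan]; infer_instance

theorem wordSpan_le_lowerCentralSeries {ι : Type*} (x : ι → L) (n : ℕ) :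
    wordSpan K x n ≤ (LieModule.lowerCentralSeries K L L n).toSubmodule := by
  induction n with
  | zero => intro u _; simp
  | succ n ih =>
    refine iSup_le fun i => ?_
    rintro _ ⟨u, hu, rfl⟩
    rw [LieModule.lowerCentralSeries_succ]
    exact LieSubmodule.lie_mem_lie (LieSubmodule.mem_top _) (ih hu)

theorem finite_of_nilpotent {ι : Type*} [Finite ι] {x : ι → L}
    (hx : LieSubalgebra.lieSpan K L (Set.range x) = ⊤) {c : ℕ}
    (hc : LieModule.lowerCentralSeries K L L c = ⊥) : Module.Finite K L := by
  have hbot : ∀ n, c ≤ n → wordSpan K x n = ⊥ := fun n hn => by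
    refine eq_bot_iff.2 fun u hu => ?_
    have := LieModule.antitone_lowerCentralSeries K L L hn
      (wordSpan_le_lowerCentralSeries x n hu)
    rw [hc] at this
    exact (LieSubmodule.mem_bot u).1 this
  -- Words of length above `c` vanish, so finitely many finite-dimensional spans suffice.
  have htop : (⨆ n : Fin (c + 1), wordSpan K x n) = ⊤ := by
    refine submodule_eq_top_of_lie_mem hx _ (fun i => ?_) (fun i w hw => ?_)
    · exact Submodule.mem_iSup_of_mem (p := fun n : Fin (c + 1) => wordSpan K x n) 0
        (Submodule.subset_span ⟨i, rfl⟩)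
    · have : (⨆ n : Fin (c + 1), wordSpan K x n) ≤
          (⨆ n : Fin (c + 1), wordSpan K x n).comap (LieAlgebra.ad K L (x i) : L →ₗ[K] L) := by
        refine iSup_le fun n u hu => ?_
        have hmem : ⁅x i, u⁆ ∈ wordSpan K x (n + 1) :=
          Submodule.mem_iSup_of_mem i ⟨u, hu, rfl⟩
        change ⁅x i, u⁆ ∈ (⨆ n : Fin (c + 1), wordSpan K x n)
        by_cases h : (n : ℕ) + 1 ≤ c
        · exact Submodule.mem_iSup_of_mem (p := fun n : Fin (c + 1) => wordSpan K x n)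
            ⟨n + 1, by omega⟩ hmem
        · rw [hbot _ (by omega)] at hmem
          rw [(Submodule.mem_bot K).1 hmem]
          exact Submodule.zero_mem _
      exact this hw
  have := fun n : Fin (c + 1) => finite_wordSpan (K := K) x n
  have hfin : Module.Finite K (⨆ n : Fin (c + 1), wordSpan K x n : Submodule K L) := inferInstance
  rw [htop] at hfin
  exact Module.Finite.equiv (Submodule.topEquiv (R := K) (M := L))

theorem span_sup_lowerCentralSeries_one {ι : Type*} {x : ι → L}
    (hx : LieSubalgebra.lieSpan K L (Set.range x) = ⊤) :
    Submodule.span K (Set.range x) ⊔ (LieModule.lowerCentralSeries K L L 1).toSubmodule = ⊤ := by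
  refine submodule_eq_top_of_lie_mem hx _
    (fun i => Submodule.mem_sup_left (Submodule.subset_span ⟨i, rfl⟩))
    (fun i w _ => Submodule.mem_sup_right ?_)
  rw [LieModule.lowerCentralSeries_succ]
  exact LieSubmodule.lie_mem_lie (LieSubmodule.mem_top _) (LieSubmodule.mem_top _)

theorem finrank_le_card_add_finrank_lowerCentralSeries_one [Module.Finite K L]
    {ι : Type*} [Fintype ι] {x : ι → L}
    (hx : LieSubalgebra.lieSpan K L (Set.range x) = ⊤) :
    Module.finrank K L ≤
      Fintype.card ι + Module.finrank K (LieModule.lowerCentralSeries K L L 1) := by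
  have h := Submodule.finrank_add_le_finrank_add_finrank (Submodule.span K (Set.range x))
    (LieModule.lowerCentralSeries K L L 1).toSubmodule
  rw [span_sup_lowerCentralSeries_one hx, finrank_top] at h
  exact h.trans (Nat.add_le_add_right (finrank_range_le_card x) _)

theorem isLieAbelian_of_lie_self_eq_bot {I : LieIdeal K L} (h : ⁅I, I⁆ = ⊥) :
    IsLieAbelian (I.toLieSubalgebra K L) := by
  rw [LieSubmodule.lie_eq_bot_iff] at h
  exact ⟨fun a b => Subtype.ext (h a a.2 b b.2)⟩

/-- The bilinear form `(x, y) ↦ ℓ([x, y])`. -/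
def bracketForm (l : Module.Dual K L) : LinearMap.BilinForm K L :=
  (LieAlgebra.ad K L : L →ₗ[K] Module.End K L).compr₂ l

theorem bracketForm_apply (l : Module.Dual K L) (a b : L) : bracketForm l a b = l ⁅a, b⁆ := rfl

theorem ker_bracketForm (l : Module.Dual K L) :
    LinearMap.ker (bracketForm l) = (radical K l).toSubmodule := by
  ext y
  refine ⟨fun h x => ?_, fun h => LinearMap.ext fun x => ?_⟩
  · rw [← lie_skew, map_neg, ← bracketForm_apply, LinearMap.mem_ker.1 h, LinearMap.zero_apply,
      neg_zero]
  · rw [bracketForm_apply, ← lie_skew, map_neg, h x, neg_zero, LinearMap.zero_apply]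

/-- Isotropic subspaces of the alternating form attached to `ℓ` bound the radical of `ℓ`. -/
theorem two_mul_finrank_le [Module.Finite K L] (l : Module.Dual K L) (H : LieSubalgebra K L)
    (hH : IsLieAbelian H) :
    2 * Module.finrank K H ≤ Module.finrank K L + Module.finrank K (radical K l) := by
  have h := LinearMap.BilinForm.finrank_add_finrank_orthogonal' (B := bracketForm l) H.toSubmodule
  -- `H` is abelian, hence isotropic.
  have h1 : H.toSubmodule ≤ (bracketForm l).orthogonal H.toSubmodule := by
    intro b hb a ha
    have : ⁅(⟨a, ha⟩ : H), (⟨b, hb⟩ : H)⁆ = 0 := trivial_lie_zero H H _ _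
    change l ⁅a, b⁆ = 0
    rw [← map_zero l]
    exact congrArg l (congrArg Subtype.val this)
  have h2 := Submodule.finrank_mono h1
  have h3 : Module.finrank K (H.toSubmodule ⊓ LinearMap.ker (bracketForm l) : Submodule K L) ≤
      Module.finrank K (radical K l) := by
    rw [ker_bracketForm]
    exact Submodule.finrank_mono inf_le_right
  change Module.finrank K H ≤ _ at h2
  change Module.finrank K H + _ = _ at h
  omega

/-- Elements `x i`, `y j` on which the form of `ℓ` has matrix `(* 1; -1 0)` bound the radical of
`ℓ` from above. -/
theorem finrank_radical_add_le [Module.Finite K L] {ι : Type*} [Fintype ι] [DecidableEq ι]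
    (l : Module.Dual K L) (x y : ι → L) (hxy : ∀ i j, l ⁅x i, y j⁆ = if i = j then 1 else 0)
    (hyy : ∀ i j, l ⁅y i, y j⁆ = 0) :
    Module.finrank K (radical K l) + 2 * Fintype.card ι ≤ Module.finrank K L := by
  let Φ : L →ₗ[K] (ι → K) × (ι → K) :=
    (LinearMap.pi fun i => bracketForm l (x i)).prod (LinearMap.pi fun i => bracketForm l (y i))
  have hyx : ∀ i j, l ⁅y i, x j⁆ = if i = j then -1 else 0 := fun i j => by
    rw [← lie_skew, map_neg, hxy]
    by_cases h : i = j
    · subst h; simp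
    · simp [h, Ne.symm h]
  have hsurj : Function.Surjective Φ := by
    rintro ⟨a, b⟩
    -- The system is block triangular: `u` fixes the pairings with the `y i`, and a combination of
    -- the `y j` then corrects those with the `x i` without disturbing them.
    let u : L := -∑ j, b j • x j
    refine ⟨u + ∑ j, (a j - l ⁅x j, u⁆) • y j, ?_⟩
    refine Prod.ext (funext fun i => ?_) (funext fun i => ?_)
    · change bracketForm l (x i) _ = a i
      rw [map_add, map_sum]
      simp [bracketForm_apply, hxy]
    · change bracketForm l (y i) _ = b i
      rw [map_add, map_sum]
      simp [bracketForm_apply, hyy, hyx, u, lie_sum]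
  have hker : (radical K l).toSubmodule ≤ LinearMap.ker Φ := by
    intro r hr
    exact LinearMap.mem_ker.2 (Prod.ext (funext fun i => hr (x i)) (funext fun i => hr (y i)))
  have h := LinearMap.finrank_range_add_finrank_ker Φ
  rw [LinearMap.range_eq_top.2 hsurj, finrank_top, Module.finrank_prod,
    Module.finrank_fintype_fun_eq_card] at h
  have h2 := Submodule.finrank_mono hker
  change Module.finrank K (radical K l) ≤ _ at h2
  omega

/-- The index and the maximal dimension of an abelian subalgebra, from a large abelian subalgebra
and a linear form with small radical. -/
theorem index_and_alpha_eq [Module.Finite K L] (m : ℕ) (H : LieSubalgebra K L)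
    (hH : IsLieAbelian H) (hm : Module.finrank K L ≤ m + Module.finrank K H)
    (l : Module.Dual K L)
    (hl : Module.finrank K (radical K l) + 2 * m ≤ Module.finrank K L) :
    index K L + 2 * m = Module.finrank K L ∧ alpha K L + m = Module.finrank K L := by
  have hindex_le : index K L ≤ Module.finrank K (radical K l) := ciInf_le (OrderBot.bddBelow _) l
  have hindex_ge : Module.finrank K L - 2 * m ≤ index K L :=
    le_ciInf fun l' => by have := two_mul_finrank_le l' H hH; omega
  -- Boundedness matters for both estimates of `alpha`: an unbounded `sSup` in `ℕ` is `0`.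
  have hbound : ∀ d ∈ {d : ℕ | ∃ H : LieSubalgebra K L, IsLieAbelian H ∧ Module.finrank K H = d},
      d ≤ Module.finrank K L - m := by
    rintro _ ⟨H', hH', rfl⟩
    have := two_mul_finrank_le l H' hH'
    omega
  have halpha_le : alpha K L ≤ Module.finrank K L - m := csSup_le ⟨_, H, hH, rfl⟩ hbound
  have halpha_ge : Module.finrank K H ≤ alpha K L := le_csSup ⟨_, hbound⟩ ⟨H, hH, rfl⟩
  omega

end General

/-! ### A 3-step metabelian test algebra -/

section ShiftAlgebra

/-- The vector space `K^ι × K^ι × K`, carrying the bracket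
`[(v, w, z), (v', w', z')] = (0, (v j v' (σ j) - v' j v (σ j))_j, ∑ j, (v j w' j - v' j w j))`. -/
def ShiftAlgebra (K : Type*) {ι : Type*} (_σ : ι → ι) : Type _ := (ι → K) × (ι → K) × K

namespace ShiftAlgebra

variable {K : Type*} [Field K] {ι : Type*} {σ : ι → ι}

instance : AddCommGroup (ShiftAlgebra K σ) := inferInstanceAs (AddCommGroup ((ι → K) × (ι → K) × K))

instance : Module K (ShiftAlgebra K σ) := inferInstanceAs (Module K ((ι → K) × (ι → K) × K))

/-- The degree one component. -/
def degOne : ShiftAlgebra K σ →ₗ[K] (ι → K) := LinearMap.fst K (ι → K) ((ι → K) × K)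

/-- The degree two component. -/
def degTwo : ShiftAlgebra K σ →ₗ[K] (ι → K) :=
  LinearMap.fst K (ι → K) K ∘ₗ LinearMap.snd K (ι → K) ((ι → K) × K)

/-- The degree three component. -/
def degThree : ShiftAlgebra K σ →ₗ[K] K :=
  LinearMap.snd K (ι → K) K ∘ₗ LinearMap.snd K (ι → K) ((ι → K) × K)

theorem ext {a b : ShiftAlgebra K σ} (h1 : ∀ j, degOne a j = degOne b j)
    (h2 : ∀ j, degTwo a j = degTwo b j) (h3 : degThree a = degThree b) : a = b :=
  Prod.ext (funext h1) (Prod.ext (funext h2) h3)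

section Bracket

variable [Fintype ι]

instance : Bracket (ShiftAlgebra K σ) (ShiftAlgebra K σ) where
  bracket a b :=
    (0, fun j => degOne a j * degOne b (σ j) - degOne b j * degOne a (σ j),
      ∑ j, (degOne a j * degTwo b j - degOne b j * degTwo a j))

theorem degOne_lie (a b : ShiftAlgebra K σ) : degOne ⁅a, b⁆ = 0 := rfl

theorem degTwo_lie (a b : ShiftAlgebra K σ) (j : ι) :
    degTwo ⁅a, b⁆ j = degOne a j * degOne b (σ j) - degOne b j * degOne a (σ j) := rfl

theorem degThree_lie (a b : ShiftAlgebra K σ) :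
    degThree ⁅a, b⁆ = ∑ j, (degOne a j * degTwo b j - degOne b j * degTwo a j) := rfl

instance : LieRing (ShiftAlgebra K σ) where
  add_lie a b c := by
    refine ext (fun j => ?_) (fun j => ?_) ?_
    · simp [degOne_lie]
    · simp only [degTwo_lie, map_add, Pi.add_apply]; ring
    · simp only [degThree_lie, map_add, Pi.add_apply, ← Finset.sum_add_distrib]
      exact Finset.sum_congr rfl fun j _ => by ring
  lie_add a b c := by
    refine ext (fun j => ?_) (fun j => ?_) ?_
    · simp [degOne_lie]
    · simp only [degTwo_lie, map_add, Pi.add_apply]; ring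
    · simp only [degThree_lie, map_add, Pi.add_apply, ← Finset.sum_add_distrib]
      exact Finset.sum_congr rfl fun j _ => by ring
  lie_self a := by
    refine ext (fun j => ?_) (fun j => ?_) ?_
    · simp [degOne_lie]
    · simp [degTwo_lie]
    · simp [degThree_lie]
  leibniz_lie a b c := by
    refine ext (fun j => ?_) (fun j => ?_) ?_
    · simp [degOne_lie]
    · simp [degTwo_lie, degOne_lie]
    -- The Jacobi identity already holds for each summand `j` separately.
    · simp only [degThree_lie, degTwo_lie, degOne_lie, map_add, Pi.zero_apply,
        ← Finset.sum_add_distrib]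
      exact Finset.sum_congr rfl fun j _ => by ring

instance : LieAlgebra K (ShiftAlgebra K σ) where
  lie_smul t a b := by
    refine ext (fun j => ?_) (fun j => ?_) ?_
    · simp [degOne_lie]
    · simp only [degTwo_lie, map_smul, Pi.smul_apply, smul_eq_mul]; ring
    · simp only [degThree_lie, map_smul, Pi.smul_apply, smul_eq_mul, Finset.mul_sum]
      exact Finset.sum_congr rfl fun j _ => by ring

theorem lie_eq_zero {a b : ShiftAlgebra K σ} (ha : degOne a = 0) (hb : degOne b = 0) :
    ⁅a, b⁆ = 0 :=
  ext (fun j => by simp [degOne_lie]) (fun j => by simp [degTwo_lie, ha, hb])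
    (by simp [degThree_lie, ha, hb])

theorem degOne_eq_zero_of_mem {a : ShiftAlgebra K σ}
    (ha : a ∈ LieModule.lowerCentralSeries K (ShiftAlgebra K σ) (ShiftAlgebra K σ) 1) :
    degOne a = 0 := by
  rw [LieModule.lowerCentralSeries_succ, ← LieSubmodule.mem_toSubmodule,
    LieSubmodule.lieIdeal_oper_eq_linear_span'] at ha
  refine (Submodule.span_le (p := LinearMap.ker (degOne (K := K) (σ := σ)))).2 ?_ ha
  rintro _ ⟨u, _, v, _, rfl⟩
  exact degOne_lie u v

theorem degTwo_eq_zero_of_mem {a : ShiftAlgebra K σ}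
    (ha : a ∈ LieModule.lowerCentralSeries K (ShiftAlgebra K σ) (ShiftAlgebra K σ) 2) :
    degTwo a = 0 := by
  rw [LieModule.lowerCentralSeries_succ, ← LieSubmodule.mem_toSubmodule,
    LieSubmodule.lieIdeal_oper_eq_linear_span'] at ha
  refine (Submodule.span_le (p := LinearMap.ker (degTwo (K := K) (σ := σ)))).2 ?_ ha
  rintro _ ⟨u, _, v, hv, rfl⟩
  refine LinearMap.mem_ker.2 (funext fun j => ?_)
  simp [degTwo_lie, degOne_eq_zero_of_mem hv]

theorem lowerCentralSeries_three_eq_bot :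
    LieModule.lowerCentralSeries K (ShiftAlgebra K σ) (ShiftAlgebra K σ) 3 = ⊥ := by
  rw [LieModule.lowerCentralSeries_succ, LieSubmodule.lie_eq_bot_iff]
  intro u _ v hv
  have h1 := degOne_eq_zero_of_mem
    (LieModule.antitone_lowerCentralSeries K _ _ (by norm_num : 1 ≤ 2) hv)
  exact ext (fun j => by simp [degOne_lie]) (fun j => by simp [degTwo_lie, h1])
    (by simp [degThree_lie, h1, degTwo_eq_zero_of_mem hv])

end Bracket

variable [DecidableEq ι]

/-- The generator with index `i`. -/
def gen (σ : ι → ι) (i : ι) : ShiftAlgebra K σ := (Pi.single i 1, 0, 0)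

theorem degOne_gen (i : ι) : degOne (gen σ i : ShiftAlgebra K σ) = Pi.single i 1 := rfl

/-- The inner bracket is the `j`-th basis vector of degree two: the other term could contribute only
at `k = σ j` with `σ k = j`, which `hσ` excludes. -/
theorem degThree_gen_lie_lie [Fintype ι] (hσ : ∀ j, σ (σ j) ≠ j) (i j : ι) :
    degThree ⁅(gen σ i : ShiftAlgebra K σ), ⁅(gen σ j : ShiftAlgebra K σ), (gen σ (σ j) : ShiftAlgebra K σ)⁆⁆ =
      if i = j then 1 else 0 := by
  simp only [degThree_lie, degOne_lie, degTwo_lie, degOne_gen, Pi.zero_apply, zero_mul, sub_zero]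
  rw [Finset.sum_eq_single i (fun k _ hk => by simp [hk]) (by simp)]
  by_cases h : i = j
  · subst h
    have h : σ i ≠ i := fun h => hσ i (by rw [h, h])
    simp [h]
  · by_cases h' : i = σ j
    · subst h'
      simp [Pi.single_apply, h, hσ j]
    · simp [Pi.single_apply, h, h']

end ShiftAlgebra

end ShiftAlgebra

/-! ### The free metabelian nilpotent algebra and its linear form -/

section FreeMetabelian

variable (K : Type*) [Field K] (g c : ℕ)

theorem lieSpan_range_of (X : Type*) :
    LieSubalgebra.lieSpan K (FreeLieAlgebra K X) (Set.range (FreeLieAlgebra.of K)) = ⊤ := by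
  set S := LieSubalgebra.lieSpan K (FreeLieAlgebra K X) (Set.range (FreeLieAlgebra.of K)) with hS
  let f : FreeLieAlgebra K X →ₗ⁅K⁆ S :=
    FreeLieAlgebra.lift K fun i => ⟨FreeLieAlgebra.of K i, LieSubalgebra.subset_lieSpan ⟨i, rfl⟩⟩
  -- By the universal property the identity factors through `S`.
  have hf : S.incl.comp f = LieHom.id := FreeLieAlgebra.hom_ext fun i => by simp [f]
  refine eq_top_iff.2 fun u _ => ?_
  have : S.incl (f u) = u := LieHom.congr_fun hf u
  rw [← this]
  exact (f u).2

/-- The projection from the free Lie algebra to the free metabelian nilpotent Lie algebra. -/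
noncomputable def toFreeMetabelian : FreeLieAlgebra K (Fin g) →ₗ⁅K⁆ FreeMetabelian K g c :=
  (quotientMk _).comp (quotientMk _)

theorem toFreeMetabelian_surjective : Function.Surjective (toFreeMetabelian K g c) :=
  (quotientMk_surjective _).comp (quotientMk_surjective _)

/-- The standard generators of the free metabelian nilpotent Lie algebra. -/
noncomputable def freeMetabelianGen (i : Fin g) : FreeMetabelian K g c :=
  toFreeMetabelian K g c (FreeLieAlgebra.of K i)

theorem lieSpan_freeMetabelianGen :
    LieSubalgebra.lieSpan K (FreeMetabelian K g c) (Set.range (freeMetabelianGen K g c)) = ⊤ := by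
  have h : (LieSubalgebra.lieSpan K _ (Set.range (freeMetabelianGen K g c))).comap
      (toFreeMetabelian K g c) = ⊤ := by
    rw [eq_top_iff, ← lieSpan_range_of, LieSubalgebra.lieSpan_le]
    rintro _ ⟨i, rfl⟩
    exact LieSubalgebra.subset_lieSpan ⟨i, rfl⟩
  refine eq_top_iff.2 fun u _ => ?_
  obtain ⟨v, rfl⟩ := toFreeMetabelian_surjective K g c u
  have hv : v ∈ (⊤ : LieSubalgebra K (FreeLieAlgebra K (Fin g))) := LieSubalgebra.mem_top v
  rwa [← h] at hv

theorem lowerCentralSeries_freeMetabelian_eq_bot :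
    LieModule.lowerCentralSeries K (FreeMetabelian K g c) (FreeMetabelian K g c) c = ⊥ := by
  refine lowerCentralSeries_eq_bot_of_surjective (toFreeMetabelian_surjective K g c)
    fun x hx => ?_
  -- `lcsTerm` at `c + 1` unfolds to Mathlib's term `c`, so `hx` applies.
  have : quotientMk (lcsTerm K (FreeLieAlgebra K (Fin g)) (c + 1)) x = 0 :=
    quotientMk_eq_zero.2 hx
  change quotientMk _ (quotientMk _ x) = 0
  rw [this, map_zero]

instance finite_freeMetabelian : Module.Finite K (FreeMetabelian K g c) :=
  finite_of_nilpotent (lieSpan_freeMetabelianGen K g c)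
    (lowerCentralSeries_freeMetabelian_eq_bot K g c)

theorem lie_lowerCentralSeries_one_freeMetabelian :
    ⁅LieModule.lowerCentralSeries K (FreeMetabelian K g c) (FreeMetabelian K g c) 1,
      LieModule.lowerCentralSeries K (FreeMetabelian K g c) (FreeMetabelian K g c) 1⁆ = ⊥ := by
  have hs := quotientMk_surjective
    ⁅lcsTerm K (FreeNilpotent K g c) 2, lcsTerm K (FreeNilpotent K g c) 2⁆
  rw [← LieIdeal.lowerCentralSeries_map_eq 1 hs, ← LieIdeal.map_bracket_eq _ hs,
    LieIdeal.map_eq_bot_iff]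
  exact fun x hx => quotientMk_eq_zero.2 hx

variable {K g c}

/-- The universal property of the free metabelian nilpotent Lie algebra, for the shift algebra. -/
noncomputable def toShiftAlgebra (hc : 3 ≤ c) (σ : Fin g → Fin g) :
    FreeMetabelian K g c →ₗ⁅K⁆ ShiftAlgebra K σ :=
  quotientLift _
    (quotientLift _ (FreeLieAlgebra.lift K (ShiftAlgebra.gen σ)) fun x hx => by
      have h := LieModule.antitone_lowerCentralSeries K (ShiftAlgebra K σ) (ShiftAlgebra K σ) hc
        (map_mem_lowerCentralSeries (FreeLieAlgebra.lift K (ShiftAlgebra.gen (K := K) σ)) _ hx)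
      rwa [ShiftAlgebra.lowerCentralSeries_three_eq_bot, LieSubmodule.mem_bot] at h)
    fun x hx => by
      revert x
      refine (LieSubmodule.lie_le_iff (N' := LieHom.ker _) _ _).2 fun a ha b hb => ?_
      rw [LieHom.mem_ker, LieHom.map_lie]
      exact ShiftAlgebra.lie_eq_zero
        (ShiftAlgebra.degOne_eq_zero_of_mem (map_mem_lowerCentralSeries _ 1 ha))
        (ShiftAlgebra.degOne_eq_zero_of_mem (map_mem_lowerCentralSeries _ 1 hb))

theorem toShiftAlgebra_gen (hc : 3 ≤ c) (σ : Fin g → Fin g) (i : Fin g) :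
    toShiftAlgebra hc σ (freeMetabelianGen K g c i) = ShiftAlgebra.gen σ i :=
  FreeLieAlgebra.lift_of_apply (R := K) (ShiftAlgebra.gen σ) i

/-- A cyclic shift of order at least three has no point of period one or two. -/
theorem exists_shift (hg : 3 ≤ g) : ∃ σ : Fin g → Fin g, ∀ j, σ (σ j) ≠ j := by
  refine ⟨fun j => if h : (j : ℕ) + 1 < g then ⟨j + 1, h⟩ else ⟨0, by omega⟩, fun j hj => ?_⟩
  have hj' := congrArg Fin.val hj
  have := j.2
  by_cases h : (j : ℕ) + 1 < g
  · by_cases h2 : (j : ℕ) + 1 + 1 < g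
    · simp [h, h2] at hj'
      omega
    · simp [h, h2] at hj'
      omega
  · simp [h, show 1 < g by omega] at hj'
    omega

theorem exists_finrank_radical_add_le (hg : 3 ≤ g) (hc : 3 ≤ c) :
    ∃ l : Module.Dual K (FreeMetabelian K g c),
      Module.finrank K (radical K l) + 2 * g ≤ Module.finrank K (FreeMetabelian K g c) := by
  obtain ⟨σ, hσ⟩ := exists_shift hg
  let φ : FreeMetabelian K g c →ₗ⁅K⁆ ShiftAlgebra K σ := toShiftAlgebra hc σ
  let x := freeMetabelianGen K g c
  refine ⟨ShiftAlgebra.degThree ∘ₗ (φ : FreeMetabelian K g c →ₗ[K] ShiftAlgebra K σ), ?_⟩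
  have h := finrank_radical_add_le
    (ShiftAlgebra.degThree ∘ₗ (φ : FreeMetabelian K g c →ₗ[K] ShiftAlgebra K σ)) x
    -- These commutators pair dually with the generators and, having images of degree at least two,
    -- commute after applying `φ`.
    (fun j => ⁅x j, x (σ j)⁆) (fun i j => ?_) (fun i j => ?_)
  · rwa [Fintype.card_fin] at h
  · change ShiftAlgebra.degThree (φ ⁅x i, ⁅x j, x (σ j)⁆⁆) = _
    rw [LieHom.map_lie, LieHom.map_lie]
    simp only [φ, x, toShiftAlgebra_gen]
    exact ShiftAlgebra.degThree_gen_lie_lie hσ i j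
  · change ShiftAlgebra.degThree (φ ⁅⁅x i, x (σ i)⁆, ⁅x j, x (σ j)⁆⁆) = _
    rw [LieHom.map_lie, LieHom.map_lie, LieHom.map_lie,
      ShiftAlgebra.lie_eq_zero (ShiftAlgebra.degOne_lie _ _) (ShiftAlgebra.degOne_lie _ _),
      map_zero]

end FreeMetabelian

end LieIndex

theorem theorem5p2 (K : Type*) [Field K] [CharZero K] (g c : ℕ) (hg : 3 ≤ g) (hc : 3 ≤ c) :
    Module.Finite K (LieIndex.FreeMetabelian K g c) ∧
    (LieIndex.index K (LieIndex.FreeMetabelian K g c) : ℤ) =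
      (Module.finrank K (LieIndex.FreeMetabelian K g c) : ℤ) - 2 * (g : ℤ) ∧
    (LieIndex.index K (LieIndex.FreeMetabelian K g c) : ℤ) =
      2 * (LieIndex.alpha K (LieIndex.FreeMetabelian K g c) : ℤ) -
        (Module.finrank K (LieIndex.FreeMetabelian K g c) : ℤ) ∧
    (LieIndex.alpha K (LieIndex.FreeMetabelian K g c) : ℤ) =
      (Module.finrank K (LieIndex.FreeMetabelian K g c) : ℤ) - (g : ℤ) := by
  obtain ⟨l, hl⟩ := LieIndex.exists_finrank_radical_add_le (K := K) hg hc
  have hH := LieIndex.isLieAbelian_of_lie_self_eq_bot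
    (LieIndex.lie_lowerCentralSeries_one_freeMetabelian K g c)
  have hdim := LieIndex.finrank_le_card_add_finrank_lowerCentralSeries_one
    (LieIndex.lieSpan_freeMetabelianGen K g c)
  rw [Fintype.card_fin] at hdim
  have h := LieIndex.index_and_alpha_eq g _ hH hdim l hl
  exact ⟨inferInstance, by omega, by omega, by omega⟩
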